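/- Let $\mathcal A$ be a unital $C^*$-algebra and let $H_{\mathcal A}=\ell^2(\mathcal A)$ be the standard right Hilbert $\mathcal A$-module, i.e. the module of all sequences $x=(x_i)_{i\in\mathbb N}$ in $\mathcal A$ for which $\sum_i x_i^*x_i$ converges in norm, with inner product $\langle x,y\rangle=\sum_i x_i^*y_i$. For a Hilbert $\mathcal A$-module $E$, let $B^a(E)$ be the set of bounded $\mathcal A$-linear adjointable operators on $E$. An operator $T\in B^a(E)$ is called $\mathcal A$-Fredholm, written $T\in\mathcal M\Phi(E)$, if there are closed submodules $M_1,N_1,M_2,N_2$ of $E$ such that $E=M_1\tilde\oplus N_1=M_2\tilde\oplus N_2$ (direct sums, not necessarily orthogonal), $N_1$ and $N_2$ are finitely generated $\mathcal A$-modules, $T(M_1)\subseteq M_2$, $T(N_1)\subseteq N_2$, and $T|_{M_1}:M_1\to M_2$ is an isomorphism (a bijection, bounded with bounded inverse). Let $F,P\in B^a(H_{\mathcal A})$, and suppose that $P$ is a (not necessarily orthogonal) projection, $P^2=P$, whose kernel $N(P)$ is finitely generated. Let $R(P)$ be the range of $P$, regarded as a Hilbert $\mathcal A$-module with the inner product of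 $H_{\mathcal A}$. Then $$F\in\mathcal M\Phi(H_{\mathcal A})\quad\Longleftrightarrow\quad PF|_{R(P)}\in\mathcal M\Phi(R(P)).$$ -/

import Mathlib

/-! Hilbert C⋆-modules.  Mathlib's class `CStarModule B E` asks for a scalar action of `B` on `E` and
a `B`-valued inner product with `⟪x, b • y⟫ = b * ⟪x, y⟫`.  A *right* Hilbert module `E` over a
C⋆-algebra `A`, with `⟪x, y a⟫ = ⟪x, y⟫ a`, is therefore the same thing as a
`CStarModule Aᵐᵒᵖ E`: `MulOpposite.op a • x` is `x a`, and the inner product is stored as an element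
of the opposite algebra. -/

section Adjointable

variable {B E F : Type*} [CStarAlgebra B] [PartialOrder B] [StarOrderedRing B]
  [NormedAddCommGroup E] [NormedSpace ℂ E] [Module B E] [CStarModule B E]
  [NormedAddCommGroup F] [NormedSpace ℂ F] [Module B F] [CStarModule B F]

/-- A bounded `B`-linear operator `T : E → F` between Hilbert `B`-modules is adjointable if there is
a bounded `B`-linear `S : F → E` with `⟪T x, y⟫ = ⟪x, S y⟫` for all `x`, `y`. -/
def IsAdjointable (T : E →L[B] F) : Prop :=
  ∃ S : F →L[B] E, ∀ (x : E) (y : F), inner B (T x) y = inner B x (S y)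

/-- `T : E → F` is a `B`-Fredholm operator: it is adjointable and there are decompositions
`E = M₁ ⊕ N₁` and `F = M₂ ⊕ N₂` into (not necessarily orthogonal) direct sums of closed submodules,
with `N₁` and `N₂` finitely generated, with respect to which `T` has a diagonal matrix
`diag (T₁, T₄)` (that is, `T M₁ ⊆ M₂` and `T N₁ ⊆ N₂`) whose entry `T₁ : M₁ → M₂` is an
isomorphism. -/
def IsFredholmOperator (T : E →L[B] F) : Prop :=
  IsAdjointable T ∧
    ∃ (M₁ N₁ : Submodule B E) (M₂ N₂ : Submodule B F),
      IsClosed (M₁ : Set E) ∧ IsClosed (N₁ : Set E) ∧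
      IsClosed (M₂ : Set F) ∧ IsClosed (N₂ : Set F) ∧
      IsCompl M₁ N₁ ∧ IsCompl M₂ N₂ ∧ N₁.FG ∧ N₂.FG ∧
      (∃ T₁ : M₁ ≃L[B] M₂, ∀ x : M₁, (T₁ x : F) = T x) ∧
      (∀ x ∈ N₁, T x ∈ N₂)

/-- A submodule of a Hilbert `B`-module, with the restricted inner product. -/
noncomputable instance Submodule.instCStarModule [IsScalarTower ℂ B E] (S : Submodule B E) :
    CStarModule B S where
  inner x y := inner B (x : E) (y : E)
  inner_add_right := by simp
  inner_self_nonneg := CStarModule.inner_self_nonneg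
  inner_self {x} := by simpa using CStarModule.inner_self (A := B) (x := (x : E))
  inner_op_smul_right := by simp
  inner_smul_right_complex := by simp
  star_inner x y := by simp
  norm_eq_sqrt_norm_inner_self x := CStarModule.norm_eq_sqrt_norm_inner_self (A := B) (x : E)

/-- The compression `P F|_{R(P)} : R(P) → R(P)`, where `R(P)` is the range of `P`. -/
def compression (P F : E →L[B] E) :
    LinearMap.range (P : E →ₗ[B] E) →L[B] LinearMap.range (P : E →ₗ[B] E) :=
  ((P.comp F).comp (LinearMap.range (P : E →ₗ[B] E)).subtypeL).codRestrict _
    fun x => LinearMap.mem_range_self (P : E →ₗ[B] E) (F x)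

end Adjointable

section StandardModule

variable (A : Type*) [CStarAlgebra A] [PartialOrder A] [StarOrderedRing A]

/-- Comparison test in a C⋆-algebra. -/
theorem summable_of_nonneg_le_cstar {f g : ℕ → A} (hf : ∀ i, 0 ≤ f i) (hfg : ∀ i, f i ≤ g i)
    (hg : Summable g) : Summable f := by
  rw [summable_iff_vanishing_norm] at hg ⊢
  intro ε hε
  obtain ⟨s, hs⟩ := hg ε hε
  refine ⟨s, fun t ht => lt_of_le_of_lt ?_ (hs t ht)⟩
  exact CStarAlgebra.norm_le_norm_of_nonneg_of_le (Finset.sum_nonneg fun i _ => hf i)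
    (Finset.sum_le_sum fun i _ => hfg i)

theorem summable_star_add_mul_add {x y : ℕ → A} (hx : Summable fun i => star (x i) * x i)
    (hy : Summable fun i => star (y i) * y i) :
    Summable fun i => star (x i + y i) * (x i + y i) := by
  refine summable_of_nonneg_le_cstar A (fun i => star_mul_self_nonneg _) (fun i => ?_)
    ((hx.add hy).add (hx.add hy))
  rw [← sub_nonneg]
  have h := star_mul_self_nonneg (x i - y i)
  convert h using 1
  simp only [star_add, star_sub]
  noncomm_ring

/-- The square-summable sequences, as a right submodule of `ℕ → A`. -/
def squareSummable : Submodule Aᵐᵒᵖ (ℕ → A) where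
  carrier := {x | Summable fun i => star (x i) * x i}
  zero_mem' := by simp
  add_mem' hx hy := summable_star_add_mul_add A hx hy
  smul_mem' a x hx := by
    have h := (hx.mul_left (star a.unop)).mul_right a.unop
    simpa [mul_assoc] using h

/-- The standard Hilbert module `H_A = ℓ²(A)` over a unital C⋆-algebra `A`: the sequences `x` in `A`
for which `∑ i, x i⋆ * x i` converges in norm, with `(x a) i = x i * a` and
`⟪x, y⟫ = ∑ i, x i⋆ * y i`.  (For series of positive elements of a C⋆-algebra, convergence of the
partial sums and unconditional summability are the same.) -/
def StandardModule : Type _ := squareSummable A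

namespace StandardModule

noncomputable instance : AddCommGroup (StandardModule A) :=
  inferInstanceAs (AddCommGroup (squareSummable A))

noncomputable instance : Module Aᵐᵒᵖ (StandardModule A) :=
  inferInstanceAs (Module Aᵐᵒᵖ (squareSummable A))

noncomputable instance : Module ℂ (StandardModule A) :=
  inferInstanceAs (Module ℂ (squareSummable A))

instance : IsScalarTower ℂ Aᵐᵒᵖ (StandardModule A) :=
  inferInstanceAs (IsScalarTower ℂ Aᵐᵒᵖ (squareSummable A))

instance : CoeFun (StandardModule A) (fun _ => ℕ → A) := ⟨fun x => x.1⟩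

variable {A}

theorem summable_self (x : StandardModule A) : Summable fun i => star (x i) * x i := x.2

@[ext] theorem ext {x y : StandardModule A} (h : ∀ i, x i = y i) : x = y :=
  Subtype.ext (funext h)

@[simp] theorem add_apply (x y : StandardModule A) (i : ℕ) : (x + y) i = x i + y i := rfl
@[simp] theorem zero_apply (i : ℕ) : (0 : StandardModule A) i = 0 := rfl
@[simp] theorem op_smul_apply (a : Aᵐᵒᵖ) (x : StandardModule A) (i : ℕ) :
    (a • x) i = x i * a.unop := rfl
@[simp] theorem smul_apply (z : ℂ) (x : StandardModule A) (i : ℕ) : (z • x) i = z • x i := rfl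

theorem summable_inner (x y : StandardModule A) : Summable fun i => star (x i) * y i := by
  have h₁ := summable_self (x + y)
  have h₂ := summable_self (x + Complex.I • y)
  have h₃ := (summable_self x).add (summable_self y)
  have h := ((h₁.sub h₃).sub ((h₂.sub h₃).const_smul Complex.I)).const_smul (1 / 2 : ℂ)
  refine h.congr fun i => ?_
  simp only [add_apply, smul_apply, star_add, star_smul, add_mul, mul_add, smul_mul_assoc,
    mul_smul_comm, smul_sub, smul_add, smul_smul, Complex.star_def, Complex.conj_I]
  match_scalars <;> ring_nf <;> simp <;> norm_num

variable (A)

noncomputable instance : Norm (StandardModule A) where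
  norm x := √‖∑' i, star (x i) * x i‖

noncomputable instance : CStarModule Aᵐᵒᵖ (StandardModule A) where
  inner x y := MulOpposite.op (∑' i, star (x i) * y i)
  inner_add_right {x y z} := by
    simp only [add_apply, mul_add, ← MulOpposite.op_add]
    rw [(summable_inner x y).tsum_add (summable_inner x z)]
  inner_self_nonneg {x} := by
    rw [MulOpposite.op_nonneg]
    exact tsum_nonneg fun i => star_mul_self_nonneg _
  inner_self {x} := by
    rw [MulOpposite.op_eq_zero_iff]
    refine ⟨fun h => ?_, fun h => by simp [h]⟩
    ext i
    have h₁ := (summable_self x).le_tsum i fun j _ => star_mul_self_nonneg _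
    rw [h] at h₁
    exact CStarRing.star_mul_self_eq_zero_iff _ |>.mp (le_antisymm h₁ (star_mul_self_nonneg _))
  inner_op_smul_right {a x y} := by
    simp only [op_smul_apply, ← mul_assoc]
    rw [(summable_inner x y).tsum_mul_right]
    simp
  inner_smul_right_complex {z x y} := by
    simp only [smul_apply, mul_smul_comm, ← MulOpposite.op_smul]
    rw [(summable_inner x y).tsum_const_smul]
  star_inner x y := by
    simp only [← MulOpposite.op_star, tsum_star, star_mul, star_star]
  norm_eq_sqrt_norm_inner_self x := rfl

noncomputable instance : NormedAddCommGroup (StandardModule A) :=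
  NormedAddCommGroup.ofCore (CStarModule.normedSpaceCore Aᵐᵒᵖ)

noncomputable instance : NormedSpace ℂ (StandardModule A) :=
  NormedSpace.ofCore (CStarModule.normedSpaceCore Aᵐᵒᵖ)

variable {A} in
theorem inner_def (x y : StandardModule A) :
    inner Aᵐᵒᵖ x y = MulOpposite.op (∑' i, star (x i) * y i) := rfl

end StandardModule

end StandardModule

/-! The proof shows that, on the modules in question, an adjointable operator is Fredholm if and only
if it is invertible modulo operators of finite rank (`HasParametrix`); the equivalence then follows
because `P` differs from the identity by an operator of finite rank, so compressing to the range of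
`P` is multiplicative up to finite rank (`hasParametrix_compression`,
`hasParametrix_of_compression`).

A Fredholm operator has a parametrix on every Hilbert module: the inverse of its isomorphism part
leaves as errors the projections onto the two finitely generated summands, and these have finite
rank because the identity of a finitely generated Hilbert module has finite rank
(`CStarModule.isFiniteRank_id_of_fg`, by invertibility of the frame operator).

Conversely, let `T S = 1 - K` with `K` of finite rank. If there is an idempotent `q` of finite rank
with `(1 - q) K` small, then `1 - (1 - q) K` is invertible, and correcting `S` by its inverse gives
`J` with `J T J = J` which is still a parametrix; the idempotents `J T` and `T J` provide the
decompositions (`HasParametrix.isFredholmOperator`). Such `q` exist on the standard module, namely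
truncations to finitely many coordinates, and the property passes to the range of `P` by conjugating
`q` with an invertible operator close to the identity so that it fixes the kernel of `P`
(`HasFiniteRankApprox.range`).

The compression is adjointable because the inclusion of the range of an adjointable idempotent is
(`exists_adjoint_subtype_range`). -/

open Filter Topology

/-! ### Invertibility of bounded module maps -/

section Invertibility

variable {B E : Type*} [CStarAlgebra B] [NormedAddCommGroup E] [NormedSpace ℂ E] [CompleteSpace E]
  [Module B E] [IsScalarTower ℂ B E]

/-- Only the base field matters for the open mapping theorem: a bijective bounded module map has a
bounded inverse. -/
theorem ContinuousLinearMap.isUnit_of_bijective_restrictScalars {T : E →L[B] E}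
    (hT : Function.Bijective T) : IsUnit T := by
  have hopen : IsOpenMap T := (T.restrictScalars ℂ).isOpenMap hT.2
  let e := LinearEquiv.ofBijective (T : E →ₗ[B] E) hT
  have he : ∀ x, e x = T x := fun _ => rfl
  have hcont : Continuous e.symm := by
    refine continuous_def.2 fun s hs => ?_
    convert hopen s hs using 1
    ext y
    refine ⟨fun hy => ⟨e.symm y, hy, e.apply_symm_apply y⟩, ?_⟩
    rintro ⟨x, hx, rfl⟩
    rw [← he]
    simpa using hx
  refine ⟨⟨T, ⟨e.symm, hcont⟩, ?_, ?_⟩, rfl⟩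
  · ext y; exact e.apply_symm_apply y
  · ext x; exact e.symm_apply_apply x

theorem ContinuousLinearMap.isUnit_of_isUnit_restrictScalars {T : E →L[B] E}
    (hT : IsUnit (T.restrictScalars ℂ)) : IsUnit T :=
  isUnit_of_bijective_restrictScalars (isUnit_iff_bijective.1 hT)

theorem ContinuousLinearMap.isUnit_one_sub_of_bound {T : E →L[B] E} {c : ℝ} (hc : c < 1)
    (hT : ∀ x, ‖T x‖ ≤ c * ‖x‖) : IsUnit (1 - T) := by
  apply isUnit_of_isUnit_restrictScalars
  have h : ‖T.restrictScalars ℂ‖ ≤ max c 0 :=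
    opNorm_le_bound _ (le_max_right _ _) fun x => (hT x).trans (by gcongr; exact le_max_left _ _)
  exact (Units.oneSub (T.restrictScalars ℂ)
    (h.trans_lt (max_lt hc one_pos))).isUnit

/-- If all `T + t` with `t ≥ 0` are bounded below by the same constant, then invertibility
propagates from `T + t`, `t` large, down to `T`. -/
theorem ContinuousLinearMap.isUnit_of_forall_add_boundedBelow {T : E →L[ℂ] E} {c : ℝ} (hc : 0 < c)
    (hT : ∀ t : ℝ, 0 ≤ t → ∀ x, c * ‖x‖ ≤ ‖T x + (t : ℂ) • x‖) : IsUnit T := by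
  nontriviality (E →L[ℂ] E)
  let S : ℝ → E →L[ℂ] E := fun t => T + (t : ℂ) • 1
  have hS : ∀ t x, S t x = T x + (t : ℂ) • x := fun t x => rfl
  have step : ∀ t, 0 ≤ t → IsUnit (S (t + c / 2)) → IsUnit (S t) := by
    rintro t ht ⟨u, hu⟩
    have hinv : ‖(↑u⁻¹ : E →L[ℂ] E)‖ ≤ c⁻¹ := by
      refine opNorm_le_bound _ (by positivity) fun x => ?_
      have h := hT (t + c / 2) (by positivity) ((↑u⁻¹ : E →L[ℂ] E) x)
      have h' : S (t + c / 2) ((↑u⁻¹ : E →L[ℂ] E) x) = x := by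
        rw [← hu, ← mul_apply_eq_comp, Units.mul_inv]; rfl
      rw [← hS, h'] at h
      rw [inv_mul_eq_div, le_div_iff₀ hc, mul_comm]
      exact h
    refine (Units.ofNearby u (S t) ?_).isUnit
    have hsub : S t - u = (-(c / 2 : ℝ) : ℂ) • (1 : E →L[ℂ] E) := by
      rw [hu]
      simp only [S, Complex.ofReal_add, add_smul, neg_smul]
      abel
    rw [hsub]
    calc ‖(-(c / 2 : ℝ) : ℂ) • (1 : E →L[ℂ] E)‖ ≤ c / 2 := by
            rw [norm_smul, norm_neg, Complex.norm_real, Real.norm_of_nonneg (by positivity)]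
            exact mul_le_of_le_one_right (by positivity) norm_id_le
      _ < c := by linarith
      _ ≤ ‖(↑u⁻¹ : E →L[ℂ] E)‖⁻¹ := by
            rw [le_inv_comm₀ hc (Units.norm_pos _)]
            exact hinv
  have descend : ∀ n : ℕ, IsUnit (S (n * (c / 2))) → IsUnit (S 0) := by
    intro n
    induction n with
    | zero => simp
    | succ n ih =>
      intro h
      refine ih (step _ (by positivity) ?_)
      convert h using 2
      push_cast; ring
  obtain ⟨n, hn⟩ := exists_nat_gt (‖T‖ / (c / 2))
  rw [div_lt_iff₀ (by positivity)] at hn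
  have h0 := descend n ?_
  · simpa [S] using h0
  · have : Nontrivial E := by
      by_contra hE
      rw [not_nontrivial_iff_subsingleton] at hE
      exact not_subsingleton _ (inferInstance : Subsingleton (E →L[ℂ] E))
    have hr : (-((n * (c / 2) : ℝ) : ℂ)) ∈ resolventSet ℂ T := by
      apply spectrum.mem_resolventSet_of_norm_lt
      rwa [norm_neg, Complex.norm_real, Real.norm_of_nonneg (by positivity)]
    rw [spectrum.mem_resolventSet_iff] at hr
    convert hr.neg using 1
    simp only [S, Algebra.algebraMap_eq_smul_one, neg_smul]
    abel

variable [PartialOrder B] [StarOrderedRing B] [CStarModule B E]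

/-- A positive operator on a Hilbert module whose quadratic form is bounded below is invertible
(the Hilbert module form of the Lax-Milgram theorem). -/
theorem CStarModule.isUnit_of_coercive {T : E →L[B] E} {C : ℝ}
    (hpos : ∀ x, 0 ≤ inner B x (T x)) (hC : ∀ x, ‖x‖ ^ 2 ≤ C * ‖inner B x (T x)‖) :
    IsUnit T := by
  apply ContinuousLinearMap.isUnit_of_isUnit_restrictScalars
  have hD : 0 < max C 1 := by positivity
  refine ContinuousLinearMap.isUnit_of_forall_add_boundedBelow (c := (max C 1)⁻¹)
    (by positivity) fun t ht x => ?_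
  rcases eq_or_ne x 0 with rfl | hx
  · simp
  have hle : inner B x (T x) ≤ inner B x (T x + (t : ℂ) • x) := by
    rw [CStarModule.inner_add_right, CStarModule.inner_smul_right_complex]
    have h0 : (0 : B) ≤ inner B x x := CStarModule.inner_self_nonneg
    rw [Complex.coe_smul]
    exact le_add_of_nonneg_right (smul_nonneg ht h0)
  have h1 := CStarAlgebra.norm_le_norm_of_nonneg_of_le (hpos x) hle
  have h2 : ‖inner B x (T x + (t : ℂ) • x)‖ ≤ ‖x‖ * ‖T x + (t : ℂ) • x‖ := CStarModule.norm_inner_le E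
  have h3 : ‖x‖ ^ 2 ≤ max C 1 * (‖x‖ * ‖T x + (t : ℂ) • x‖) :=
    calc ‖x‖ ^ 2 ≤ C * ‖inner B x (T x)‖ := hC x
      _ ≤ max C 1 * ‖inner B x (T x)‖ := by gcongr; exact le_max_left _ _
      _ ≤ _ := by gcongr; exact h1.trans h2
  have hx' : 0 < ‖x‖ := norm_pos_iff.2 hx
  rw [inv_mul_le_iff₀ hD]
  show ‖x‖ ≤ max C 1 * ‖T x + (t : ℂ) • x‖
  nlinarith

end Invertibility

/-! ### Operators of finite rank -/

section FiniteRank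

variable {B D E F : Type*} [CStarAlgebra B]
  [NormedAddCommGroup D] [Module B D] [NormedAddCommGroup E] [Module B E]
  [NormedAddCommGroup F] [Module B F]

/-- A bounded `B`-linear operator is of finite rank if it is a finite sum of operators
`x ↦ φ x • u`, that is, if it factors through a finitely generated free module by bounded maps.
The functionals `φ` need not be represented by vectors, so this makes sense without adjoints. -/
def IsFiniteRank (K : E →L[B] F) : Prop :=
  ∃ (n : ℕ) (u : Fin n → F) (φ : Fin n → E →L[B] B), ∀ x, K x = ∑ i, φ i x • u i

namespace IsFiniteRank

theorem add {K L : E →L[B] F} (hK : IsFiniteRank K) (hL : IsFiniteRank L) :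
    IsFiniteRank (K + L) := by
  obtain ⟨n, u, φ, h⟩ := hK
  obtain ⟨m, v, ψ, h'⟩ := hL
  refine ⟨n + m, Fin.append u v, Fin.append φ ψ, fun x => ?_⟩
  simp [Fin.sum_univ_add, h, h']

theorem comp_left {K : D →L[B] E} (hK : IsFiniteRank K) (L : E →L[B] F) :
    IsFiniteRank (L.comp K) := by
  obtain ⟨n, u, φ, h⟩ := hK
  exact ⟨n, fun i => L (u i), φ, fun x => by simp [h]⟩

theorem comp_right {K : E →L[B] F} (hK : IsFiniteRank K) (L : D →L[B] E) :
    IsFiniteRank (K.comp L) := by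
  obtain ⟨n, u, φ, h⟩ := hK
  exact ⟨n, u, fun i => (φ i).comp L, fun x => by simp [h]⟩

theorem neg {K : E →L[B] F} (hK : IsFiniteRank K) : IsFiniteRank (-K) := by
  obtain ⟨n, u, φ, h⟩ := hK
  exact ⟨n, fun i => -u i, φ, fun x => by simp [h]⟩

theorem sub {K L : E →L[B] F} (hK : IsFiniteRank K) (hL : IsFiniteRank L) :
    IsFiniteRank (K - L) := by
  rw [sub_eq_add_neg]
  exact hK.add hL.neg

theorem mul_left {K : E →L[B] E} (hK : IsFiniteRank K) (L : E →L[B] E) : IsFiniteRank (L * K) :=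
  hK.comp_left L

theorem mul_right {K : E →L[B] E} (hK : IsFiniteRank K) (L : E →L[B] E) : IsFiniteRank (K * L) :=
  hK.comp_right L

theorem range_fg {e : E →L[B] E} (he : IsFiniteRank e) (hidem : IsIdempotentElem e) :
    (LinearMap.range (e : E →ₗ[B] E)).FG := by
  obtain ⟨n, u, φ, h⟩ := he
  have h2 : ∀ x, e (e x) = e x := fun x => DFunLike.congr_fun hidem x
  refine Submodule.fg_def.2 ⟨Set.range fun i => e (u i), Set.finite_range _, le_antisymm ?_ ?_⟩
  · rw [Submodule.span_le]
    rintro _ ⟨i, rfl⟩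
    exact ⟨u i, rfl⟩
  · rintro _ ⟨x, rfl⟩
    have : e x = ∑ i, φ i x • e (u i) := by
      rw [← h2, h x, map_sum]
      simp
    rw [ContinuousLinearMap.coe_coe, this]
    exact Submodule.sum_mem _ fun i _ =>
      Submodule.smul_mem _ _ (Submodule.subset_span ⟨i, rfl⟩)

end IsFiniteRank

end FiniteRank

/-! ### Finitely generated Hilbert modules -/

section FinitelyGenerated

variable {B E F : Type*} [CStarAlgebra B] [PartialOrder B] [StarOrderedRing B]
  [NormedAddCommGroup E] [NormedSpace ℂ E] [Module B E] [IsScalarTower ℂ B E] [CompleteSpace E]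
  [CStarModule B E]
  [NormedAddCommGroup F] [Module B F]

theorem CStarModule.norm_smul_le {B E : Type*} [CStarAlgebra B] [PartialOrder B]
    [NormedAddCommGroup E] [NormedSpace ℂ E] [Module B E] [CStarModule B E] (b : B) (x : E) : ‖b • x‖ ≤ ‖b‖ * ‖x‖ := by
  have h : ‖b • x‖ ^ 2 ≤ (‖b‖ * ‖x‖) ^ 2 := by
    rw [CStarModule.norm_sq_eq B, CStarModule.inner_op_smul_right, CStarModule.inner_op_smul_left]
    calc ‖b * (inner B x x * star b)‖ ≤ ‖b‖ * (‖inner B x x‖ * ‖star b‖) :=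
          (norm_mul_le _ _).trans (by gcongr; exact norm_mul_le _ _)
      _ = (‖b‖ * ‖x‖) ^ 2 := by rw [norm_star, ← CStarModule.norm_sq_eq B]; ring
  exact (pow_le_pow_iff_left₀ (norm_nonneg _) (by positivity) two_ne_zero).1 h

/-- The functional `⟪u, ·⟫` as a bounded `B`-linear map. -/
noncomputable def CStarModule.innerFunctional (u : E) : E →L[B] B where
  toFun x := inner B u x
  map_add' x y := CStarModule.inner_add_right
  map_smul' b x := by simp
  cont := (CStarModule.innerSL (A := B) u).continuous

theorem CStarModule.exists_coeff_bound {B E : Type*} [CStarAlgebra B] [PartialOrder B]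
    [NormedAddCommGroup E] [NormedSpace ℂ E] [Module B E] [IsScalarTower ℂ B E] [CompleteSpace E]
    [CStarModule B E] {n : ℕ} {u : Fin n → E}
    (hu : Submodule.span B (Set.range u) = ⊤) :
    ∃ C : ℝ, 0 < C ∧ ∀ x : E, ∃ a : Fin n → B, (∑ i, a i • u i = x) ∧ ∀ i, ‖a i‖ ≤ C * ‖x‖ := by
  let L : (Fin n → B) →ₗ[ℂ] E := (Fintype.linearCombination B u).restrictScalars ℂ
  have hL : ∀ a, L a = ∑ i, a i • u i := fun a => rfl
  have hcont : Continuous L := by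
    refine AddMonoidHomClass.continuous_of_bound L (∑ i, ‖u i‖) fun a => ?_
    rw [hL, Finset.sum_mul]
    refine norm_sum_le_of_le _ fun i _ => (CStarModule.norm_smul_le _ _).trans ?_
    rw [mul_comm]
    gcongr
    exact norm_le_pi_norm a i
  have hsurj : Function.Surjective (⟨L, hcont⟩ : (Fin n → B) →L[ℂ] E) := by
    intro x
    have hx : x ∈ Submodule.span B (Set.range u) := hu ▸ Submodule.mem_top
    obtain ⟨a, ha⟩ := (Submodule.mem_span_range_iff_exists_fun B).1 hx
    exact ⟨a, ha⟩
  obtain ⟨C, hC, h⟩ := ContinuousLinearMap.exists_preimage_norm_le _ hsurj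
  refine ⟨C, hC, fun x => ?_⟩
  obtain ⟨a, ha, hn⟩ := h x
  exact ⟨a, ha, fun i => (norm_le_pi_norm a i).trans hn⟩

/-- The identity of a finitely generated Hilbert module has finite rank: if `u₁, …, uₙ` generate,
the frame operator `x ↦ ∑ ⟪uᵢ, x⟫ uᵢ` is invertible. -/
theorem CStarModule.isFiniteRank_id_of_fg (h : (⊤ : Submodule B E).FG) :
    IsFiniteRank (ContinuousLinearMap.id B E) := by
  obtain ⟨n, u, hu⟩ := Submodule.fg_iff_exists_fin_generating_family.1 h
  obtain ⟨C, hC, hco⟩ := CStarModule.exists_coeff_bound hu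
  let φ : Fin n → E →L[B] B := fun i => CStarModule.innerFunctional (u i)
  have hφ : ∀ i x, φ i x = inner B (u i) x := fun _ _ => rfl
  have hcont : Continuous fun x => ∑ i, φ i x • u i := by
    refine continuous_finsetSum _ fun i _ => ?_
    let s : B →+ E := (LinearMap.toSpanSingleton B E (u i)).toAddMonoidHom
    have hs : Continuous s :=
      AddMonoidHomClass.continuous_of_bound s ‖u i‖ fun b =>
        (CStarModule.norm_smul_le b (u i)).trans_eq (mul_comm _ _)
    exact hs.comp (φ i).continuous
  let T : E →L[B] E :=
    { toFun := fun x => ∑ i, φ i x • u i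
      map_add' := fun x y => by simp [add_smul, Finset.sum_add_distrib]
      map_smul' := fun b x => by simp [mul_smul, Finset.smul_sum]
      cont := hcont }
  have hT : ∀ x, T x = ∑ i, φ i x • u i := fun _ => rfl
  have hinner : ∀ x, inner B x (T x) = ∑ i, inner B (u i) x * star (inner B (u i) x) := by
    intro x
    rw [hT, CStarModule.inner_sum_right]
    refine Finset.sum_congr rfl fun i _ => ?_
    rw [CStarModule.inner_op_smul_right, hφ, CStarModule.star_inner]
  have hterm : ∀ x i, ‖inner B (u i) x‖ ^ 2 ≤ ‖inner B x (T x)‖ := by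
    intro x i
    rw [hinner, sq, ← CStarRing.norm_self_mul_star]
    exact CStarAlgebra.norm_le_norm_of_nonneg_of_le (mul_star_self_nonneg _)
      (Finset.single_le_sum (f := fun i => inner B (u i) x * star (inner B (u i) x))
        (fun i _ => mul_star_self_nonneg _) (Finset.mem_univ i))
  have hunit : IsUnit T := by
    refine CStarModule.isUnit_of_coercive (C := (n * C) ^ 2) (fun x => ?_) fun x => ?_
    · rw [hinner]
      exact Finset.sum_nonneg fun i _ => mul_star_self_nonneg _
    · obtain ⟨a, ha, hn⟩ := hco x
      set N := ‖inner B x (T x)‖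
      -- expanding one argument of `⟪x, x⟫` in the generators bounds `‖x‖` by the coefficients
      have h1 : ‖x‖ ^ 2 ≤ n * (C * ‖x‖ * √N) := by
        rw [CStarModule.norm_sq_eq B]
        nth_rewrite 2 [← ha]
        rw [CStarModule.inner_sum_right]
        refine (norm_sum_le_of_le (f := fun i => inner B x (a i • u i)) _ fun i _ => ?_).trans_eq
          (b := ∑ _i : Fin n, C * ‖x‖ * √N) (by simp)
        rw [CStarModule.inner_op_smul_right]
        refine (norm_mul_le _ _).trans ?_
        gcongr
        · exact hn i
        · rw [← CStarModule.star_inner, norm_star]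
          exact Real.le_sqrt_of_sq_le (hterm x i)
      rcases (norm_nonneg x).eq_or_lt with hx | hx
      · rw [← hx]; simpa using by positivity
      · have h2 : ‖x‖ ≤ n * C * √N := by
          have : ‖x‖ * ‖x‖ ≤ (n * C * √N) * ‖x‖ := by nlinarith
          exact le_of_mul_le_mul_right this hx
        calc ‖x‖ ^ 2 ≤ (n * C * √N) ^ 2 := by gcongr
          _ = (n * C) ^ 2 * N := by rw [mul_pow, Real.sq_sqrt (norm_nonneg _)]
  obtain ⟨w, hw⟩ := hunit
  have hfin : IsFiniteRank T := ⟨n, u, φ, hT⟩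
  have : ContinuousLinearMap.id B E = (↑w⁻¹ : E →L[B] E).comp T := by
    rw [← hw]
    exact w.inv_mul.symm
  rw [this]
  exact hfin.comp_left _

/-- A bounded operator into a Hilbert module whose values lie in a finitely generated closed
submodule has finite rank. -/
theorem IsFiniteRank.of_forall_mem {N : Submodule B E} (hN : IsClosed (N : Set E)) (hfg : N.FG)
    (K : F →L[B] E) (hK : ∀ x, K x ∈ N) : IsFiniteRank K := by
  have : CompleteSpace N := hN.completeSpace_coe
  have h := CStarModule.isFiniteRank_id_of_fg ((Submodule.fg_top N).2 hfg)
  exact (h.comp_right (K.codRestrict N hK)).comp_left N.subtypeL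

end FinitelyGenerated

/-! ### Parametrices -/

/-- A bounded module map `T` has a parametrix if it is invertible modulo operators of finite rank
in the ring of all bounded module maps. Adjoints play no role. -/
def HasParametrix {B E : Type*} [CStarAlgebra B] [NormedAddCommGroup E] [Module B E]
    (T : E →L[B] E) : Prop :=
  ∃ S : E →L[B] E, IsFiniteRank (1 - S * T) ∧ IsFiniteRank (1 - T * S)

/-- The identity of `E` is a limit, in the topology of pointwise convergence, of idempotents of
finite rank. No uniform bound on the norms of the idempotents is asked for. -/
def HasFiniteRankApprox (B E : Type*) [CStarAlgebra B] [NormedAddCommGroup E] [Module B E] : Prop :=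
  ∀ (n : ℕ) (u : Fin n → E) (ε : ℝ), 0 < ε →
    ∃ q : E →L[B] E, IsIdempotentElem q ∧ IsFiniteRank q ∧ ∀ i, ‖q (u i) - u i‖ ≤ ε

section Projection

variable {B E : Type*} [CStarAlgebra B] [NormedAddCommGroup E] [NormedSpace ℂ E] [CompleteSpace E]
  [Module B E] [IsScalarTower ℂ B E]

/-- Closed complementary submodules of a Banach module are topological complements. -/
theorem Submodule.isTopCompl_of_isClosed_of_isScalarTower {M N : Submodule B E}
    (hM : IsClosed (M : Set E)) (hN : IsClosed (N : Set E)) (h : IsCompl M N) :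
    Submodule.IsTopCompl M N := by
  refine ⟨h, ?_⟩
  have hC : IsCompl (M.restrictScalars ℂ) (N.restrictScalars ℂ) := by
    refine ⟨?_, ?_⟩
    · rw [Submodule.disjoint_def]
      exact fun x hx hx' => Submodule.disjoint_def.1 h.disjoint x hx hx'
    · rw [codisjoint_iff, eq_top_iff]
      intro x _
      obtain ⟨y, hy, z, hz, hyz⟩ := Submodule.mem_sup.1
        (h.sup_eq_top.ge (Submodule.mem_top (x := x)))
      exact Submodule.mem_sup.2 ⟨y, hy, z, hz, hyz⟩
  exact (Submodule.IsCompl.isTopCompl_of_isClosed hC hM hN).continuous_projection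

end Projection

section Fredholm

variable {B E : Type*} [CStarAlgebra B] [PartialOrder B] [StarOrderedRing B]
  [NormedAddCommGroup E] [NormedSpace ℂ E] [Module B E] [IsScalarTower ℂ B E] [CompleteSpace E]
  [CStarModule B E]

/-- The inverse of the isomorphism part of a Fredholm operator, extended by zero, is a
parametrix. -/
theorem IsFredholmOperator.hasParametrix {T : E →L[B] E} (hT : IsFredholmOperator T) :
    HasParametrix T := by
  obtain ⟨-, M₁, N₁, M₂, N₂, hM₁, hN₁, hM₂, hN₂, h₁, h₂, fg₁, fg₂, ⟨T₁, hT₁⟩, hTN⟩ := hT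
  have c₁ := Submodule.isTopCompl_of_isClosed_of_isScalarTower hM₁ hN₁ h₁
  have c₂ := Submodule.isTopCompl_of_isClosed_of_isScalarTower hM₂ hN₂ h₂
  let S : E →L[B] E := M₁.subtypeL.comp ((T₁.symm : M₂ →L[B] M₁).comp (M₂.projectionOntoL N₂ c₂))
  have hSM : ∀ x : M₂, S x = T₁.symm x := fun x => by
    simp [S, Submodule.projectionOntoL_apply_left]
  have hSN : ∀ x ∈ N₂, S x = 0 := fun x hx => by
    have : M₂.projectionOntoL N₂ c₂ x = 0 := (Submodule.projectionOntoL_apply_eq_zero_iff c₂).2 hx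
    simp [S, this]
  refine ⟨S, IsFiniteRank.of_forall_mem hN₁ fg₁ _ fun x => ?_,
    IsFiniteRank.of_forall_mem hN₂ fg₂ _ fun x => ?_⟩
  · obtain ⟨m, hm, n, hn, rfl⟩ := Submodule.mem_sup.1
      (h₁.sup_eq_top.ge (Submodule.mem_top (x := x)))
    have h : S (T m) = m := by
      have := hSM (T₁ ⟨m, hm⟩)
      rwa [hT₁, T₁.symm_apply_apply] at this
    have h' : (1 - S * T) (m + n) = n := by
      simp [h, hSN _ (hTN n hn)]
    rwa [h']
  · obtain ⟨m, hm, n, hn, rfl⟩ := Submodule.mem_sup.1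
      (h₂.sup_eq_top.ge (Submodule.mem_top (x := x)))
    have h : T (S m) = m := by
      rw [hSM ⟨m, hm⟩, ← hT₁, T₁.apply_symm_apply]
    have h' : (1 - T * S) (m + n) = n := by
      simp [h, hSN n hn]
    rwa [h']

/-- A generalized inverse `J` of `T` which is also a parametrix splits `T`: the idempotents `J T`
and `T J` give the two decompositions. -/
theorem isFredholmOperator_of_mul_mul_eq {B E : Type*} [CStarAlgebra B] [PartialOrder B]
    [NormedAddCommGroup E] [NormedSpace ℂ E] [Module B E] [CStarModule B E] {T J : E →L[B] E} (hT : IsAdjointable T)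
    (hJ : J * T * J = J) (h₁ : IsFiniteRank (1 - J * T)) (h₂ : IsFiniteRank (1 - T * J)) :
    IsFredholmOperator T := by
  have he : IsIdempotentElem (J * T) := by
    rw [IsIdempotentElem, ← mul_assoc, hJ]
  have hf : IsIdempotentElem (T * J) := by
    rw [IsIdempotentElem, mul_assoc, ← mul_assoc J, hJ]
  have hJ' : ∀ x, J (T (J x)) = J x := fun x => DFunLike.congr_fun hJ x
  have ce := ContinuousLinearMap.IsIdempotentElem.isTopCompl he
  have cf := ContinuousLinearMap.IsIdempotentElem.isTopCompl hf
  -- the kernel of an idempotent `e` is the range of `1 - e`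
  have hker : ∀ e : E →L[B] E, IsIdempotentElem e → IsFiniteRank (1 - e) →
      (LinearMap.ker (e : E →ₗ[B] E)).FG := by
    intro e he hfr
    have h := hfr.range_fg he.one_sub
    convert h using 1
    ext x
    constructor
    · intro hx
      refine ⟨x, ?_⟩
      have hx' : e x = 0 := hx
      simp [hx']
    · rintro ⟨y, rfl⟩
      have : e (e y) = e y := DFunLike.congr_fun he y
      simp [this]
  let T₁ : LinearMap.range ((J * T : E →L[B] E) : E →ₗ[B] E) →L[B]
      LinearMap.range ((T * J : E →L[B] E) : E →ₗ[B] E) :=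
    (T.comp (Submodule.subtypeL _)).codRestrict _ (by
      rintro ⟨_, y, rfl⟩
      exact ⟨T y, rfl⟩)
  let J₁ : LinearMap.range ((T * J : E →L[B] E) : E →ₗ[B] E) →L[B]
      LinearMap.range ((J * T : E →L[B] E) : E →ₗ[B] E) :=
    (J.comp (Submodule.subtypeL _)).codRestrict _ (by
      rintro ⟨_, y, rfl⟩
      exact ⟨J y, rfl⟩)
  refine ⟨hT, _, _, _, _, ce.isClosed, ce.isClosed', cf.isClosed, cf.isClosed', ce.isCompl,
    cf.isCompl, hker _ he h₁, hker _ hf h₂,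
    ⟨ContinuousLinearEquiv.equivOfInverse T₁ J₁ ?_ ?_, fun x => rfl⟩, fun x hx => ?_⟩
  · rintro ⟨_, y, rfl⟩
    exact Subtype.ext (hJ' (T y))
  · rintro ⟨_, y, rfl⟩
    exact Subtype.ext (congrArg T (hJ' y))
  · have hx' : J (T x) = 0 := hx
    show T (J (T x)) = 0
    rw [hx', map_zero]

theorem HasFiniteRankApprox.exists_norm_le {B E : Type*} [CStarAlgebra B] [PartialOrder B]
    [NormedAddCommGroup E] [NormedSpace ℂ E] [Module B E] [IsScalarTower ℂ B E] [CStarModule B E]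
    (hE : HasFiniteRankApprox B E) {K : E →L[B] E} (hK : IsFiniteRank K) {n : ℕ} (u : Fin n → E)
    {ε : ℝ} (hε : 0 < ε) :
    ∃ q : E →L[B] E, IsIdempotentElem q ∧ IsFiniteRank q ∧ (∀ i, ‖q (u i) - u i‖ ≤ ε) ∧
      ∀ x, ‖q (K x) - K x‖ ≤ ε * ‖x‖ := by
  obtain ⟨m, v, φ, hφ⟩ := hK
  set C : ℝ := ∑ i, ‖(φ i).restrictScalars ℂ‖ with hC
  have hC0 : 0 ≤ C := Finset.sum_nonneg fun i _ => norm_nonneg _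
  obtain ⟨q, hq, hqf, hqu⟩ := hE (n + m) (Fin.append u v) (ε / (1 + C)) (by positivity)
  refine ⟨q, hq, hqf, fun i => ?_, fun x => ?_⟩
  · have h := hqu (Fin.castAdd m i)
    rw [Fin.append_left] at h
    exact h.trans (div_le_self hε.le (by linarith))
  · have hv : ∀ i, ‖q (v i) - v i‖ ≤ ε / (1 + C) := fun i => by
      have h := hqu (Fin.natAdd n i)
      rwa [Fin.append_right] at h
    have hx : q (K x) - K x = ∑ i, φ i x • (q (v i) - v i) := by
      simp [hφ, smul_sub]
    have hterm : ∀ i, ‖φ i x • (q (v i) - v i)‖ ≤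
        ‖(φ i).restrictScalars ℂ‖ * ‖x‖ * (ε / (1 + C)) := fun i =>
      (CStarModule.norm_smul_le _ _).trans
        (mul_le_mul (((φ i).restrictScalars ℂ).le_opNorm x) (hv i) (norm_nonneg _) (by positivity))
    calc ‖q (K x) - K x‖ ≤ ∑ i, ‖(φ i).restrictScalars ℂ‖ * ‖x‖ * (ε / (1 + C)) := by
          rw [hx]
          exact norm_sum_le_of_le _ fun i _ => hterm i
      _ = C / (1 + C) * (ε * ‖x‖) := by
          rw [← Finset.sum_mul, ← Finset.sum_mul, ← hC]
          ring
      _ ≤ ε * ‖x‖ := by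
          refine mul_le_of_le_one_left (by positivity) ?_
          rw [div_le_one (by positivity)]
          linarith

/-- If finite rank operators can be approximated by finite rank idempotents, then a parametrix can
be corrected to a generalized inverse. -/
theorem HasParametrix.isFredholmOperator {B E : Type*} [CStarAlgebra B] [PartialOrder B]
    [NormedAddCommGroup E] [NormedSpace ℂ E] [Module B E] [IsScalarTower ℂ B E] [CompleteSpace E]
    [CStarModule B E] {T : E →L[B] E} (hT : HasParametrix T)
    (hE : HasFiniteRankApprox B E) (hadj : IsAdjointable T) : IsFredholmOperator T := by
  obtain ⟨S, hST, hTS⟩ := hT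
  obtain ⟨q, hq, hqf, -, hqK⟩ :=
    hE.exists_norm_le hTS (Fin.elim0 : Fin 0 → E) (ε := 1 / 2) (by norm_num)
  set K := 1 - T * S with hKdef
  -- `(1 - q) T S = w - q` with `w` invertible: `T S` is invertible on the range of `1 - q`
  obtain ⟨w, hw⟩ : IsUnit (1 - (1 - q) * K) := by
    refine ContinuousLinearMap.isUnit_one_sub_of_bound (c := 1 / 2) (by norm_num) fun x => ?_
    rw [← norm_neg]
    simpa using hqK x
  have hqq : q * q = q := hq
  have hqr : q * (1 - q) = 0 := by rw [mul_sub, hqq, mul_one, sub_self]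
  have hrr : (1 - q) * (1 - q) = 1 - q := by rw [sub_mul, hqr, one_mul, sub_zero]
  set v : E →L[B] E := ↑w⁻¹ with hv
  have hwv : (1 - (1 - q) * K) * v = 1 := by rw [← hw]; exact w.mul_inv
  have hqv : q * v = q := by
    calc q * v = (q * (1 - (1 - q) * K)) * v := by
          rw [mul_sub, ← mul_assoc q, hqr, zero_mul, sub_zero, mul_one]
      _ = q := by rw [mul_assoc, hwv, mul_one]
  have hvexp : v = 1 + (1 - q) * K * v := by
    rw [sub_mul, one_mul, sub_eq_iff_eq_add] at hwv
    exact hwv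
  have hTSK : T * S = 1 - K := by rw [hKdef, sub_sub_cancel]
  have hr : (1 - q) * (T * S) * v = 1 - q := by
    have : (1 - q) * (T * S) = (1 - (1 - q) * K) - q := by rw [hTSK]; noncomm_ring
    rw [this, sub_mul, hwv, hqv]
  refine isFredholmOperator_of_mul_mul_eq (J := S * v * (1 - q)) hadj ?_ ?_ ?_
  · calc S * v * (1 - q) * T * (S * v * (1 - q))
        = S * v * ((1 - q) * (T * S) * v) * (1 - q) := by simp only [mul_assoc]
      _ = S * v * (1 - q) := by rw [hr, mul_assoc (S * v), hrr]
  · have : 1 - S * v * (1 - q) * T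
        = (1 - S * T) + S * q * T - S * (1 - q) * K * (v * (1 - q) * T) := by
      nth_rewrite 1 [hvexp]
      noncomm_ring
    rw [this]
    exact (hST.add ((hqf.mul_left _).mul_right _)).sub ((hTS.mul_left _).mul_right _)
  · have : 1 - T * (S * v * (1 - q))
        = K + T * S * q - T * S * (1 - q) * K * (v * (1 - q)) := by
      nth_rewrite 1 [hvexp]
      rw [hKdef]
      noncomm_ring
    rw [this]
    exact (hTS.add (hqf.mul_left _)).sub ((hTS.mul_left _).mul_right _)

end Fredholm

/-! ### Compression to the range of an idempotent -/

section Compression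

variable {B E : Type*} [CStarAlgebra B] [PartialOrder B] [StarOrderedRing B]
  [NormedAddCommGroup E] [NormedSpace ℂ E] [Module B E] [IsScalarTower ℂ B E] [CompleteSpace E]
  [CStarModule B E] {P : E →L[B] E}

/-- A bounded module map, as a map onto its range. -/
def ContinuousLinearMap.toRange {B E : Type*} [Ring B] [AddCommGroup E] [TopologicalSpace E]
    [Module B E] (P : E →L[B] E) : E →L[B] LinearMap.range (P : E →ₗ[B] E) :=
  P.codRestrict _ fun x => LinearMap.mem_range_self (P : E →ₗ[B] E) x

theorem ContinuousLinearMap.coe_toRange {B E : Type*} [Ring B] [AddCommGroup E]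
    [TopologicalSpace E] [Module B E] (P : E →L[B] E) (x : E) : (P.toRange x : E) = P x := rfl

theorem ContinuousLinearMap.apply_of_mem_range {B E : Type*} [Ring B] [AddCommGroup E]
    [TopologicalSpace E] [Module B E] {P : E →L[B] E} (hP : IsIdempotentElem P)
    (x : LinearMap.range (P : E →ₗ[B] E)) : P x = x := by
  obtain ⟨_, y, rfl⟩ := x
  exact DFunLike.congr_fun hP y

theorem isFiniteRank_one_sub_of_ker_fg (hP : IsIdempotentElem P)
    (hker : (LinearMap.ker (P : E →ₗ[B] E)).FG) : IsFiniteRank (1 - P) := by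
  refine IsFiniteRank.of_forall_mem
    (ContinuousLinearMap.IsIdempotentElem.isTopCompl hP).isClosed' hker _ fun x => ?_
  have : P (P x) = P x := DFunLike.congr_fun hP x
  simp [this]

/-- The inclusion of the range of an adjointable idempotent `P` is adjointable. On the range of `P`
the operator `P P⋆` is positive and bounded below, because `⟪x, x⟫ = ⟪x, P⋆ x⟫` there; if `D` is
its inverse then `D P P⋆` is the adjoint. -/
theorem exists_adjoint_subtype_range (hP : IsIdempotentElem P) (hadj : IsAdjointable P) :
    ∃ J : E →L[B] LinearMap.range (P : E →ₗ[B] E),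
      ∀ (x : LinearMap.range (P : E →ₗ[B] E)) (y : E),
        inner B (x : E) y = inner B x (J y) := by
  obtain ⟨Q, hQ⟩ := hadj
  have : CompleteSpace (LinearMap.range (P : E →ₗ[B] E)) :=
    (ContinuousLinearMap.IsIdempotentElem.isTopCompl hP).isClosed.completeSpace_coe
  set D : LinearMap.range (P : E →ₗ[B] E) →L[B] LinearMap.range (P : E →ₗ[B] E) :=
    P.toRange.comp (Q.comp (Submodule.subtypeL _)) with hD
  have hDc : ∀ x, (D x : E) = P (Q x) := fun x => rfl
  have hPx := ContinuousLinearMap.apply_of_mem_range hP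
  have hQ' : ∀ x y : E, inner B x (P y) = inner B (Q x) y := fun x y => by
    rw [← CStarModule.star_inner, hQ, CStarModule.star_inner]
  have hinn : ∀ x, inner B x (D x) = inner B (Q x) (Q x) := fun x => hQ' x (Q x)
  obtain ⟨w, hw⟩ : IsUnit D := by
    refine CStarModule.isUnit_of_coercive (C := 1) (fun x => ?_) fun x => ?_
    · rw [hinn]; exact CStarModule.inner_self_nonneg
    · rw [hinn, ← CStarModule.norm_sq_eq B, one_mul]
      have h : ‖(x : E)‖ ^ 2 ≤ ‖(x : E)‖ * ‖Q x‖ := by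
        have h1 : inner B (x : E) (x : E) = inner B (x : E) (Q x) := by
          nth_rewrite 1 [← hPx x]
          exact hQ x x
        rw [CStarModule.norm_sq_eq B, h1]
        exact CStarModule.norm_inner_le E
      have h' : ‖(x : E)‖ ≤ ‖Q x‖ := by
        rcases (norm_nonneg (x : E)).eq_or_lt with h0 | h0
        · rw [← h0]; exact norm_nonneg _
        · rw [sq] at h; exact le_of_mul_le_mul_left h h0
      exact pow_le_pow_left₀ (norm_nonneg _) h' 2
  set v : LinearMap.range (P : E →ₗ[B] E) →L[B] LinearMap.range (P : E →ₗ[B] E) := ↑w⁻¹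
  have hDw : ∀ y, D (v y) = y := fun y => by
    rw [← hw]; exact DFunLike.congr_fun w.mul_inv y
  refine ⟨v.comp (P.toRange.comp Q), fun x y => ?_⟩
  set z := v (P.toRange (Q y)) with hz
  have hPQ : P (Q (z : E) - Q y) = 0 := by
    rw [map_sub, ← hDc, hz, hDw, ContinuousLinearMap.coe_toRange, sub_self]
  -- `Q (z - y)` lies in the range of the adjoint and in the kernel of `P`, so it vanishes
  have hQz : Q ((z : E) - y) = 0 := by
    rw [← map_sub] at hPQ
    refine (CStarModule.inner_self (A := B)).1 ?_
    rw [← hQ', hPQ, CStarModule.inner_zero_right]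
  show inner B (x : E) y = inner B (x : E) (z : E)
  rw [← sub_eq_zero, ← CStarModule.inner_sub_right, ← hPx x, hQ, ← neg_sub, map_neg, hQz, neg_zero,
    CStarModule.inner_zero_right]

theorem isAdjointable_compression {F : E →L[B] E} (hP : IsIdempotentElem P)
    (hPadj : IsAdjointable P) (hF : IsAdjointable F) : IsAdjointable (compression P F) := by
  obtain ⟨J, hJ⟩ := exists_adjoint_subtype_range hP hPadj
  obtain ⟨Q, hQ⟩ := hPadj
  obtain ⟨G, hG⟩ := hF
  refine ⟨J.comp (G.comp (Q.comp (Submodule.subtypeL _))), fun x y => ?_⟩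
  rw [ContinuousLinearMap.comp_apply, ← hJ]
  show inner B (P (F x)) (y : E) = inner B (x : E) (G (Q y))
  rw [hQ, hG]

/-- Approximation by finite rank idempotents passes to the range of an idempotent `P` with finite
rank kernel: if `q` nearly fixes the kernel of `P`, then `Z = q (1 - P) + P` is invertible, the
idempotent `Z⁻¹ q Z` fixes the kernel of `P`, and so its compression to the range is again
idempotent. -/
theorem HasFiniteRankApprox.range {B E : Type*} [CStarAlgebra B] [PartialOrder B]
    [NormedAddCommGroup E] [NormedSpace ℂ E] [Module B E] [IsScalarTower ℂ B E] [CompleteSpace E]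
    [CStarModule B E] {P : E →L[B] E} (hE : HasFiniteRankApprox B E) (hP : IsIdempotentElem P)
    (hfin : IsFiniteRank (1 - P)) :
    HasFiniteRankApprox B (LinearMap.range (P : E →ₗ[B] E)) := by
  intro n u ε hε
  set c : ℝ := ‖P.restrictScalars ℂ‖ with hc
  obtain ⟨q, hq, hqf, hqu, hqP⟩ := hE.exists_norm_le hfin (fun i => (u i : E))
    (ε := min (1 / 2) (ε / (2 * (c + 1)))) (by positivity)
  have hZ : q * (1 - P) + P = 1 - (1 - q) * (1 - P) := by noncomm_ring
  obtain ⟨w, hw⟩ : IsUnit (q * (1 - P) + P) := by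
    rw [hZ]
    refine ContinuousLinearMap.isUnit_one_sub_of_bound (c := 1 / 2) (by norm_num) fun x => ?_
    rw [← norm_neg]
    have h := (hqP x).trans (mul_le_mul_of_nonneg_right (min_le_left _ _) (norm_nonneg x))
    simpa using h
  have hqq : q * q = q := hq
  have hPP : P * P = P := hP
  set v : E →L[B] E := ↑w⁻¹ with hv
  set Z : E →L[B] E := ↑w with hZw
  have hvZ : v * Z = 1 := w.inv_mul
  have hZv : Z * v = 1 := w.mul_inv
  have hZN : Z * (1 - P) = q * (1 - P) := by
    rw [hw, add_mul, mul_assoc, mul_sub P, hPP, mul_one, sub_self, add_zero, hP.one_sub.eq]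
  have hZP : Z * P = P := by
    rw [hw, add_mul, mul_assoc, sub_mul, hPP, one_mul, sub_self, mul_zero, zero_add]
  set Q := v * q * Z with hQdef
  have hQQ : Q * Q = Q := by
    calc Q * Q = v * q * (Z * v) * q * Z := by simp only [hQdef, mul_assoc]
      _ = Q := by rw [hZv, mul_one, mul_assoc v, hqq]
  have hQN : Q * (1 - P) = 1 - P := by
    rw [hQdef, mul_assoc, hZN, ← mul_assoc, mul_assoc v, hqq, mul_assoc, ← hZN, ← mul_assoc, hvZ,
      one_mul]
  have hPQ : P * Q * P * Q = P * Q := by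
    have h : P * Q * P * Q = P * (Q * Q) - P * (Q * (1 - P)) * Q := by noncomm_ring
    rw [h, hQQ, hQN, mul_sub, hPP, mul_one, sub_self, zero_mul, sub_zero]
  have hvbound : ∀ x, ‖v x‖ ≤ 2 * ‖x‖ := by
    intro x
    have h1 : ‖q ((1 - P) (v x)) - (1 - P) (v x)‖ ≤ 1 / 2 * ‖v x‖ :=
      (hqP (v x)).trans (mul_le_mul_of_nonneg_right (min_le_left _ _) (norm_nonneg _))
    have h2 : x = v x + (q ((1 - P) (v x)) - (1 - P) (v x)) := by
      have h3 : Z (v x) = x := DFunLike.congr_fun hZv x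
      rw [hw] at h3
      nth_rewrite 1 [← h3]
      simp
      abel
    have h4 : ‖v x‖ ≤ ‖x‖ + ‖q ((1 - P) (v x)) - (1 - P) (v x)‖ := by
      nth_rewrite 1 [eq_sub_of_add_eq h2.symm]
      exact norm_sub_le _ _
    linarith
  have hPx := ContinuousLinearMap.apply_of_mem_range hP
  have hZx : ∀ x : LinearMap.range (P : E →ₗ[B] E), Z x = x := fun x => by
    have h : Z (P x) = P x := DFunLike.congr_fun hZP (x : E)
    rwa [hPx] at h
  refine ⟨P.toRange.comp (Q.comp (Submodule.subtypeL _)), ?_, ?_, fun i => ?_⟩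
  · ext x
    exact DFunLike.congr_fun hPQ (x : E)
  · exact ((((hqf.mul_left v).mul_right Z).comp_right _).comp_left _)
  · have hvx : v (u i : E) = u i := by
      nth_rewrite 1 [← hZx (u i)]
      exact DFunLike.congr_fun hvZ (u i : E)
    have hform : P (Q (u i)) - (u i : E) = P (v (q (u i) - u i)) := by
      have : Q (u i) = v (q (u i)) := by
        show v (q (Z (u i))) = _
        rw [hZx]
      rw [this, map_sub, hvx, map_sub, hPx]
    have hle : ‖q (u i) - (u i : E)‖ ≤ ε / (2 * (c + 1)) := (hqu i).trans (min_le_right _ _)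
    show ‖P (Q (u i)) - (u i : E)‖ ≤ ε
    have hc0 : 0 ≤ c := norm_nonneg _
    rw [hform]
    calc ‖P (v (q (u i) - u i))‖ ≤ c * (2 * (ε / (2 * (c + 1)))) := by
          refine ((P.restrictScalars ℂ).le_opNorm _).trans ?_
          gcongr
          exact (hvbound _).trans (by gcongr)
      _ = c / (c + 1) * ε := by field_simp
      _ ≤ ε := by
          refine mul_le_of_le_one_left hε.le ?_
          rw [div_le_one (by positivity)]
          linarith

theorem hasParametrix_compression {B E : Type*} [CStarAlgebra B] [NormedAddCommGroup E]
    [Module B E] {P F : E →L[B] E} (hF : HasParametrix F)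
    (hP : IsIdempotentElem P) (hfin : IsFiniteRank (1 - P)) : HasParametrix (compression P F) := by
  have hPx := ContinuousLinearMap.apply_of_mem_range hP
  -- compressing to the range of `P` is multiplicative up to finite rank
  have key : ∀ G H : E →L[B] E, IsFiniteRank (1 - G * H) →
      IsFiniteRank (1 - compression P G * compression P H) := by
    intro G H h
    have : 1 - compression P G * compression P H =
        P.toRange.comp (((1 - G * H) + G * ((1 - P) * H)).comp (Submodule.subtypeL _)) := by
      ext x
      show (x : E) - P (G (P (H x))) = P ((x - G (H x)) + G (H x - P (H x)))
      simp [hPx]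
    rw [this]
    exact ((h.add ((hfin.mul_right H).mul_left G)).comp_right _).comp_left _
  obtain ⟨S, h₁, h₂⟩ := hF
  exact ⟨_, key _ _ h₁, key _ _ h₂⟩

theorem hasParametrix_of_compression {B E : Type*} [CStarAlgebra B] [NormedAddCommGroup E]
    [Module B E] {P F : E →L[B] E} (hF : HasParametrix (compression P F))
    (hP : IsIdempotentElem P) (hfin : IsFiniteRank (1 - P)) : HasParametrix F := by
  obtain ⟨S, h₁, h₂⟩ := hF
  have hPx := ContinuousLinearMap.apply_of_mem_range hP
  have hPP : ∀ x, P (P x) = P x := fun x => DFunLike.congr_fun hP x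
  let ι := Submodule.subtypeL (LinearMap.range (P : E →ₗ[B] E))
  let S' : E →L[B] E := ι.comp (S.comp P.toRange)
  refine ⟨S', ?_, ?_⟩
  · have : 1 - S' * F = (1 - P) + ι.comp ((1 - S * compression P F).comp P.toRange)
        - S' * F * (1 - P) := by
      ext x
      have hr : P.toRange (F (P x)) = compression P F (P.toRange x) := rfl
      simp [S', ι, hr, ContinuousLinearMap.coe_toRange]
    rw [this]
    exact (hfin.add ((h₁.comp_right _).comp_left _)).sub (hfin.mul_left _)
  · have : 1 - F * S' = (1 - P) + ι.comp ((1 - compression P F * S).comp P.toRange)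
        - (1 - P) * (F * S') := by
      ext x
      have hr : (compression P F (S (P.toRange x)) : E) = P (F (S (P.toRange x))) := rfl
      simp [S', ι, hr, ContinuousLinearMap.coe_toRange]
    rw [this]
    exact (hfin.add ((h₂.comp_right _).comp_left _)).sub (hfin.mul_right _)

/-- The stability of the Fredholm property under compression, for Hilbert modules whose finite rank
operators are approximated by finite rank idempotents. -/
theorem isFredholmOperator_iff_compression (hE : HasFiniteRankApprox B E) {F : E →L[B] E}
    (hF : IsAdjointable F) (hPadj : IsAdjointable P) (hP : IsIdempotentElem P)
    (hker : (LinearMap.ker (P : E →ₗ[B] E)).FG) :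
    IsFredholmOperator F ↔ IsFredholmOperator (compression P F) := by
  have hfin := isFiniteRank_one_sub_of_ker_fg hP hker
  have : CompleteSpace (LinearMap.range (P : E →ₗ[B] E)) :=
    (ContinuousLinearMap.IsIdempotentElem.isTopCompl hP).isClosed.completeSpace_coe
  exact ⟨fun h => (hasParametrix_compression h.hasParametrix hP hfin).isFredholmOperator (hE.range hP hfin)
      (isAdjointable_compression hP hPadj hF),
    fun h => (hasParametrix_of_compression h.hasParametrix hP hfin).isFredholmOperator hE hF⟩

end Compression

/-! ### The standard module -/

namespace StandardModule

variable {A : Type*} [CStarAlgebra A] [PartialOrder A] [StarOrderedRing A]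

theorem sub_apply (x y : StandardModule A) (i : ℕ) : (x - y) i = x i - y i := rfl

theorem norm_sq (x : StandardModule A) : ‖x‖ ^ 2 = ‖∑' i, star (x i) * x i‖ := by
  rw [CStarModule.norm_sq_eq Aᵐᵒᵖ, inner_def, MulOpposite.norm_op]

variable (A) in
/-- The restriction of an arbitrary sequence to a finite set of indices, as an element of the
standard module. -/
noncomputable def restrict (t : Finset ℕ) : (ℕ → A) →ₗ[Aᵐᵒᵖ] StandardModule A where
  toFun x := ⟨fun i => if i ∈ t then x i else 0,
    summable_of_ne_finset_zero (s := t) fun i hi => by simp [hi]⟩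
  map_add' x y := by
    ext i
    show (if i ∈ t then x i + y i else 0) = (if i ∈ t then x i else 0) + if i ∈ t then y i else 0
    split_ifs <;> simp
  map_smul' a x := by
    ext i
    show (if i ∈ t then x i * a.unop else 0) = (if i ∈ t then x i else 0) * a.unop
    split_ifs <;> simp

theorem restrict_apply (t : Finset ℕ) (x : ℕ → A) (i : ℕ) :
    restrict A t x i = if i ∈ t then x i else 0 := rfl

theorem norm_restrict_sq (t : Finset ℕ) (x : ℕ → A) :
    ‖restrict A t x‖ ^ 2 = ‖∑ i ∈ t, star (x i) * x i‖ := by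
  rw [norm_sq, tsum_eq_sum (s := t)]
  · congr 1
    exact Finset.sum_congr rfl fun i hi => by simp [restrict_apply, hi]
  · intro i hi
    simp [restrict_apply, hi]

theorem norm_restrict_le (t : Finset ℕ) (x : StandardModule A) : ‖restrict A t x‖ ≤ ‖x‖ := by
  rw [← pow_le_pow_iff_left₀ (norm_nonneg _) (norm_nonneg _) two_ne_zero, norm_restrict_sq, norm_sq]
  exact CStarAlgebra.norm_le_norm_of_nonneg_of_le
    (Finset.sum_nonneg fun i _ => star_mul_self_nonneg _)
    ((summable_self x).sum_le_tsum t fun i _ => star_mul_self_nonneg _)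

theorem norm_le_of_forall_restrict {x : StandardModule A} {c : ℝ}
    (h : ∀ t, ‖restrict A t x‖ ≤ c) : ‖x‖ ≤ c := by
  have hc : 0 ≤ c := (norm_nonneg _).trans (h ∅)
  rw [← pow_le_pow_iff_left₀ (norm_nonneg _) hc two_ne_zero, norm_sq]
  refine le_of_tendsto' (summable_self x).hasSum.norm fun t => ?_
  rw [← norm_restrict_sq]
  exact pow_le_pow_left₀ (norm_nonneg _) (h t) 2

theorem norm_apply_le (x : StandardModule A) (i : ℕ) : ‖x i‖ ≤ ‖x‖ := by
  refine le_trans (le_of_eq ?_) (norm_restrict_le {i} x)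
  rw [← sq_eq_sq₀ (norm_nonneg _) (norm_nonneg _), norm_restrict_sq, Finset.sum_singleton,
    CStarRing.norm_star_mul_self, sq]

/-- A sequence is square summable as soon as it is a limit of square summable sequences, uniformly
over all finite restrictions. -/
theorem summable_of_forall_exists_norm_restrict_le {y : ℕ → A}
    (h : ∀ ε > 0, ∃ x : StandardModule A, ∀ t, ‖restrict A t (y - x)‖ ≤ ε) :
    Summable fun i => star (y i) * y i := by
  rw [summable_iff_vanishing_norm]
  intro ε hε
  obtain ⟨x, hx⟩ := h (√ε / 3) (by positivity)
  obtain ⟨s, hs⟩ := summable_iff_vanishing_norm.1 (summable_self x) ((√ε / 3) ^ 2) (by positivity)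
  refine ⟨s, fun t ht => ?_⟩
  have h1 : ‖restrict A t x‖ < √ε / 3 := by
    rw [← pow_lt_pow_iff_left₀ (norm_nonneg _) (by positivity) two_ne_zero, norm_restrict_sq]
    exact hs t ht
  have h2 : restrict A t y = restrict A t (y - x) + restrict A t x := by
    rw [← map_add, sub_add_cancel]
  have h3 : ‖restrict A t y‖ < √ε := by
    rw [h2]
    refine (norm_add_le _ _).trans_lt ?_
    have : 0 < √ε := by positivity
    linarith [hx t]
  rw [← norm_restrict_sq, ← Real.sq_sqrt hε.le]
  exact pow_lt_pow_left₀ h3 (norm_nonneg _) two_ne_zero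

instance : CompleteSpace (StandardModule A) := by
  refine Metric.complete_of_cauchySeq_tendsto fun u hu => ?_
  have hcoord : ∀ i, CauchySeq fun n => u n i := fun i => by
    rw [Metric.cauchySeq_iff'] at hu ⊢
    intro ε hε
    obtain ⟨N, hN⟩ := hu ε hε
    refine ⟨N, fun n hn => lt_of_le_of_lt ?_ (hN n hn)⟩
    rw [dist_eq_norm, dist_eq_norm, ← sub_apply]
    exact norm_apply_le _ i
  choose y hy using fun i => cauchySeq_tendsto_of_complete (hcoord i)
  have hlim : ∀ ε > 0, ∃ N, ∀ n ≥ N, ∀ t, ‖restrict A t (y - u n)‖ ≤ ε := by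
    intro ε hε
    obtain ⟨N, hN⟩ := Metric.cauchySeq_iff.1 hu ε hε
    refine ⟨N, fun n hn t => ?_⟩
    rw [← pow_le_pow_iff_left₀ (norm_nonneg _) hε.le two_ne_zero, norm_restrict_sq]
    have hT : Tendsto (fun m => ‖∑ i ∈ t, star (u m i - u n i) * (u m i - u n i)‖) atTop
        (𝓝 ‖∑ i ∈ t, star (y i - u n i) * (y i - u n i)‖) := by
      refine (tendsto_finsetSum _ fun i _ => ?_).norm
      have := (hy i).sub_const (u n i)
      exact this.star.mul this
    refine le_of_tendsto hT ?_
    filter_upwards [eventually_ge_atTop N] with m hm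
    have h1 := norm_restrict_sq t (u m - u n : StandardModule A)
    have h2 : ‖restrict A t (u m - u n : StandardModule A)‖ ≤ ε :=
      (norm_restrict_le t _).trans (by rw [← dist_eq_norm]; exact (hN m hm n hn).le)
    calc _ = ‖restrict A t (u m - u n : StandardModule A)‖ ^ 2 := h1.symm
      _ ≤ ε ^ 2 := pow_le_pow_left₀ (norm_nonneg _) h2 2
  let Y : StandardModule A := ⟨y, summable_of_forall_exists_norm_restrict_le fun ε hε =>
    (hlim ε hε).imp' u fun N h => h N le_rfl⟩
  refine ⟨Y, Metric.tendsto_atTop.2 fun ε hε => ?_⟩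
  obtain ⟨N, hN⟩ := hlim (ε / 2) (half_pos hε)
  refine ⟨N, fun n hn => ?_⟩
  rw [dist_comm, dist_eq_norm]
  exact (norm_le_of_forall_restrict (x := Y - u n) fun t => hN n hn t).trans_lt (half_lt_self hε)

variable (A) in
/-- The `i`-th coordinate as a bounded module map. -/
noncomputable def coord (i : ℕ) : StandardModule A →L[Aᵐᵒᵖ] Aᵐᵒᵖ where
  toFun x := MulOpposite.op (x i)
  map_add' x y := rfl
  map_smul' a x := rfl
  cont := by
    let c : StandardModule A →+ Aᵐᵒᵖ :=
      { toFun := fun x => MulOpposite.op (x i), map_zero' := rfl, map_add' := fun _ _ => rfl }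
    exact AddMonoidHomClass.continuous_of_bound c 1 fun x => by
      rw [one_mul]; exact norm_apply_le x i

variable (A) in
/-- The projection onto the coordinates in a finite set. -/
noncomputable def truncate (t : Finset ℕ) : StandardModule A →L[Aᵐᵒᵖ] StandardModule A where
  toFun x := restrict A t x
  map_add' x y := map_add (restrict A t) x.1 y.1
  map_smul' a x := map_smul (restrict A t) a x.1
  cont := by
    let c : StandardModule A →+ StandardModule A :=
      { toFun := fun x => restrict A t x
        map_zero' := map_zero (restrict A t)
        map_add' := fun x y => map_add (restrict A t) x.1 y.1 }
    exact AddMonoidHomClass.continuous_of_bound c 1 fun x => by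
      rw [one_mul]; exact norm_restrict_le t x

theorem truncate_apply (t : Finset ℕ) (x : StandardModule A) (i : ℕ) :
    truncate A t x i = if i ∈ t then x i else 0 := rfl

theorem isIdempotentElem_truncate (t : Finset ℕ) : IsIdempotentElem (truncate A t) := by
  refine ContinuousLinearMap.ext fun x => StandardModule.ext fun i => ?_
  show (if i ∈ t then (if i ∈ t then x i else 0) else 0) = if i ∈ t then x i else 0
  split_ifs <;> rfl

theorem isFiniteRank_truncate (m : ℕ) : IsFiniteRank (truncate A (Finset.range m)) := by
  refine ⟨m, fun j => restrict A {(j : ℕ)} 1, fun j => coord A j, fun x => ?_⟩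
  let ev : ℕ → StandardModule A →+ A := fun i =>
    { toFun := fun x => x i, map_zero' := rfl, map_add' := fun _ _ => rfl }
  ext i
  show _ = ev i _
  rw [map_sum]
  have hterm : ∀ j : Fin m, ev i (coord A j x • restrict A {(j : ℕ)} 1) =
      if i = j then x i else 0 := by
    intro j
    show (if i ∈ ({(j : ℕ)} : Finset ℕ) then (1 : A) else 0) * x j = _
    simp only [Finset.mem_singleton]
    split_ifs with h
    · rw [h, one_mul]
    · rw [zero_mul]
  rw [Finset.sum_congr rfl fun j _ => hterm j,
    Fin.sum_univ_eq_sum_range (fun j => if i = j then x i else 0) m, Finset.sum_ite_eq,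
    truncate_apply]

theorem tendsto_truncate (x : StandardModule A) :
    Tendsto (fun m => truncate A (Finset.range m) x) atTop (𝓝 x) := by
  rw [Metric.tendsto_atTop]
  intro ε hε
  obtain ⟨s, hs⟩ := summable_iff_vanishing_norm.1 (summable_self x) ((ε / 2) ^ 2) (by positivity)
  obtain ⟨N, hN⟩ := s.exists_nat_subset_range
  refine ⟨N, fun m hm => ?_⟩
  rw [dist_comm, dist_eq_norm]
  refine (norm_le_of_forall_restrict fun t => ?_).trans_lt (half_lt_self hε)
  have h : restrict A t (x - truncate A (Finset.range m) x : StandardModule A)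
      = restrict A (t \ Finset.range m) x := by
    ext i
    rw [restrict_apply, restrict_apply, sub_apply, truncate_apply]
    by_cases h1 : i ∈ t <;> by_cases h2 : i ∈ Finset.range m <;> simp [h1, h2]
  rw [h, ← pow_le_pow_iff_left₀ (norm_nonneg _) (by positivity) two_ne_zero, norm_restrict_sq]
  refine (hs _ ?_).le
  exact Finset.disjoint_left.2 fun i hi his =>
    (Finset.mem_sdiff.1 hi).2 (Finset.range_mono hm (hN his))

/-- The truncations to the first `m` coordinates witness the approximation property. -/
theorem hasFiniteRankApprox : HasFiniteRankApprox Aᵐᵒᵖ (StandardModule A) := by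
  intro n u ε hε
  have h : ∀ᶠ m in atTop, ∀ i, ‖truncate A (Finset.range m) (u i) - u i‖ ≤ ε := by
    rw [eventually_all]
    intro i
    filter_upwards [Metric.tendsto_nhds.1 (tendsto_truncate (u i)) ε hε] with m hm
    rw [← dist_eq_norm]
    exact hm.le
  obtain ⟨m, hm⟩ := h.exists
  exact ⟨_, isIdempotentElem_truncate _, isFiniteRank_truncate m, hm⟩

end StandardModule

theorem lemma3p1 {A : Type*} [CStarAlgebra A] [PartialOrder A] [StarOrderedRing A]
    (F P : StandardModule A →L[Aᵐᵒᵖ] StandardModule A)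
    (hF : IsAdjointable F) (hP : IsAdjointable P) (hPP : IsIdempotentElem P)
    (hker : (LinearMap.ker (P : StandardModule A →ₗ[Aᵐᵒᵖ] StandardModule A)).FG) :
    IsFredholmOperator F ↔ IsFredholmOperator (compression P F) :=
  isFredholmOperator_iff_compression StandardModule.hasFiniteRankApprox hF hP hPP hker
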